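/- Let $F(w)=e^{-w^2}\int_0^w e^{t^2}\,dt$ $(w\in\mathbb C)$ be Dawson's integral, let $$J_\mu(z)=\Big(\frac z2\Big)^{\mu}\sum_{k=0}^\infty\frac{(-1)^k(z/2)^{2k}}{k!\,\Gamma(\mu+k+1)}$$ be the Bessel function of the first kind, and let $j_m(z)=\sqrt{\pi/(2z)}\,J_{m+\frac12}(z)$, $m\in\mathbb Z$, be the spherical Bessel function of the first kind. Powers and square roots are principal, except that powers of $-2iz$ are taken on the branch $$(-2iz)^a=e^{-i\pi a/2}\,(2z)^a,\qquad \sqrt{-2iz}=e^{-i\pi/4}\sqrt{2z},$$ with principal $(2z)^a$, which is analytic in $z\in\mathbb C\setminus(-\infty,0]$. Then for every $m\in\mathbb Z$ and every $z\in\mathbb C\setminus(-\infty,0]$, $$j_m(z)=\sqrt2\,i^{\,m+\frac32}\,\frac{e^{iz}}{\sqrt z}\left[\frac1\pi\int_0^\pi F\!\left(-i\sqrt{-2iz}\,\cos\tfrac\theta2\right)\cos\!\big((m+\tfrac12)\theta\big)\,d\theta+i\,(-1)^m\sum_{j=1}^{-m}\frac{\Gamma(j-m-1)}{\Gamma(j)\,\Gamma(-j-m+1)}\,(-2iz)^{\frac12-j}\right],$$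 where the sum is empty, hence zero, if $m\ge 0$. In particular, for $-\pi/2<\arg z<\pi$ the same formula holds with the principal values of $\sqrt{-2iz}$ and $(-2iz)^{\frac12-j}$. -/

import Mathlib

/-- The Bessel function of the first kind `J_μ(z) = (z/2)^μ ∑ (-1)^k (z/2)^(2k) / (k! Γ(μ+k+1))`,
with the principal power. Since `Complex.Gamma` takes the value `0` at its poles, the quotient is
`0` there, in agreement with the usual convention `1/Γ = 0`. -/
noncomputable def besselJ (μ z : ℂ) : ℂ :=
  (z / 2) ^ μ *
    ∑' k : ℕ, (-1 : ℂ) ^ k * (z / 2) ^ (2 * k) / ((k.factorial : ℂ) * Complex.Gamma (μ + k + 1))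

/-- The spherical Bessel function of the first kind `j_m(z) = √(π/(2z)) J_{m+1/2}(z)`, `m ∈ ℤ`. -/
noncomputable def sphericalBesselJ (m : ℤ) (z : ℂ) : ℂ :=
  ((Real.pi : ℂ) / (2 * z)) ^ (1 / 2 : ℂ) * besselJ ((m : ℂ) + 1 / 2) z

/-- Dawson's integral `F(z) = e^{-z²} ∫_0^z e^{t²} dt` for complex `z`; the (path-independent)
integral is taken along the segment `t = s z`, `0 ≤ s ≤ 1`. -/
noncomputable def dawsonF (z : ℂ) : ℂ :=
  Complex.exp (-z ^ 2) * ∫ s in (0 : ℝ)..1, Complex.exp (((s : ℂ) * z) ^ 2) * z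

/-- The power `(-2iz)^a = e^{-iπa/2} (2z)^a`, where `(2z)^a` is the principal power. In `z` this is
the branch that is analytic on `ℂ ∖ (-∞, 0]`. -/
noncomputable def powNegTwoIMul (z a : ℂ) : ℂ :=
  Complex.exp (-(Complex.I * Real.pi * a / 2)) * (2 * z) ^ a

/-! As functions of `m`, both sides solve `f (m+1) + f (m-1) = (2m+1)/z * f m`, so agreement at `m =
0` (`sin z / z`) and `m = -1` (`cos z / z`) suffices.

On the Bessel side this is the contiguous relation of the power series, plus Legendre duplication at
orders `±1/2`. On the other side put `s = √(-2iz)`, so `s² = -2iz`. Integrating by parts with `F' =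
1 - 2wF` gives the integral a recurrence with source terms only at `m = 0` and `m = -1`
(`dawsonCosIntegral_recurrence`). The Gamma sum is a Bessel polynomial in `1/s²`; where it passes
from empty to nonempty it has the same sources (`gammaSum_recurrence`), and with its factor `i` they
cancel. The prefactor `i^(m+1)` turns differences of neighbours into sums.

The value at `m = 0` comes from termwise integration of the series of `F`: two Wallis-type integrals
multiply to `π/(2(k+1))`, leaving the series of `exp (s²) - 1` (`dawsonCosIntegral_zero`). -/

/-- Two solutions of the same two-sided three-term recurrence that agree at `0` and `-1` are
equal. -/
theorem eq_of_three_term_recurrence {f g c : ℤ → ℂ}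
    (hf : ∀ m, f (m + 1) + f (m - 1) = c m * f m) (hg : ∀ m, g (m + 1) + g (m - 1) = c m * g m)
    (h0 : f 0 = g 0) (h1 : f (-1) = g (-1)) (m : ℤ) : f m = g m := by
  have up : ∀ n : ℕ, f n = g n ∧ f (n - 1) = g (n - 1) := by
    intro n
    induction n with
    | zero => exact ⟨by simpa using h0, by simpa using h1⟩
    | succ n ih =>
      have a := hf n
      have b := hg n
      rw [ih.1, ih.2, ← b] at a
      push_cast
      exact ⟨add_right_cancel a, by simpa using ih.1⟩
  have down : ∀ n : ℕ, f (-n) = g (-n) ∧ f (-n - 1) = g (-n - 1) := by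
    intro n
    induction n with
    | zero => exact ⟨by simpa using h0, by simpa using h1⟩
    | succ n ih =>
      have a := hf (-n - 1)
      have b := hg (-n - 1)
      rw [ih.2, ← b, sub_add_cancel, ih.1] at a
      push_cast
      rw [show (-((n : ℤ) + 1)) = -n - 1 by ring]
      exact ⟨ih.2, add_left_cancel a⟩
  obtain ⟨n, rfl | rfl⟩ := m.eq_nat_or_neg
  · exact (up n).1
  · exact (down n).1

/-! ### Bessel side: power series, recurrence, initial values -/

/-- The terms of the power series factor of `besselJ μ z`. -/
noncomputable def besselTerm (μ z : ℂ) (k : ℕ) : ℂ :=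
  (-1 : ℂ) ^ k * (z / 2) ^ (2 * k) / ((k.factorial : ℂ) * Complex.Gamma (μ + k + 1))

theorem besselTerm_succ {μ z : ℂ} (hμ : ∀ n : ℕ, μ ≠ -n) (k : ℕ) (hk : μ + k + 1 ≠ 0) :
    besselTerm μ z (k + 1) = -(z / 2) ^ 2 / ((k + 1) * (μ + k + 1)) * besselTerm μ z k := by
  have hk' : ((k : ℂ) + 1) ≠ 0 := by exact_mod_cast k.succ_ne_zero
  have hf : (k.factorial : ℂ) ≠ 0 := by exact_mod_cast k.factorial_ne_zero
  have hG : Complex.Gamma (μ + k + 1) ≠ 0 := by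
    refine Complex.Gamma_ne_zero fun n hn => hμ (n + k + 1) ?_
    push_cast
    linear_combination hn
  unfold besselTerm
  rw [Nat.factorial_succ]
  push_cast
  rw [show μ + ((k : ℂ) + 1) + 1 = (μ + k + 1) + 1 by ring, Complex.Gamma_add_one _ hk]
  field_simp
  ring

theorem summable_besselTerm {μ z : ℂ} (hμ : ∀ n : ℕ, μ ≠ -n) : Summable (besselTerm μ z) := by
  have hk : ∀ k : ℕ, μ + k + 1 ≠ 0 := fun k h => hμ (k + 1) (by push_cast; linear_combination h)
  have h1 : Filter.Tendsto (fun k : ℕ => ‖μ + k + 1‖) Filter.atTop Filter.atTop := by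
    have : Filter.Tendsto (fun k : ℕ => (k : ℝ) - ‖μ + 1‖) Filter.atTop Filter.atTop :=
      Filter.tendsto_atTop_add_const_right _ _ tendsto_natCast_atTop_atTop
    refine Filter.tendsto_atTop_mono (fun k => ?_) this
    have := norm_sub_norm_le (k : ℂ) (-(μ + 1))
    rwa [norm_neg, Complex.norm_natCast, sub_neg_eq_add, ← add_assoc,
      add_comm (k : ℂ) μ] at this
  have h2 : ∀ᶠ k : ℕ in Filter.atTop, 2 * ‖(z / 2) ^ 2‖ ≤ ‖μ + k + 1‖ :=
    h1.eventually_ge_atTop _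
  refine summable_of_ratio_norm_eventually_le (r := 1 / 2) (by norm_num) ?_
  filter_upwards [h2] with k h
  rw [besselTerm_succ hμ k (hk k), norm_mul]
  refine mul_le_mul_of_nonneg_right ?_ (norm_nonneg _)
  have hpos : 0 < ‖μ + k + 1‖ := norm_pos_iff.2 (hk k)
  have hk1 : (1 : ℝ) ≤ ‖(k : ℂ) + 1‖ := by
    have : ‖(k : ℂ) + 1‖ = (k : ℝ) + 1 := by
      have := Complex.norm_natCast (k + 1)
      push_cast at this
      exact this
    rw [this]
    linarith [Nat.cast_nonneg (α := ℝ) k]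
  rw [norm_div, norm_neg, norm_mul, div_le_iff₀ (by positivity)]
  nlinarith

/-- The three-term recurrence of the power series factors. -/
theorem tsum_besselTerm_recurrence {μ z : ℂ} (hμ : ∀ n : ℤ, μ ≠ n) :
    ∑' k, besselTerm (μ - 1) z k + (z / 2) ^ 2 * ∑' k, besselTerm (μ + 1) z k =
      μ * ∑' k, besselTerm μ z k := by
  have s0 : Summable (besselTerm μ z) :=
    summable_besselTerm fun n h => hμ (-n) (by push_cast; exact h)
  have s1 : Summable (besselTerm (μ - 1) z) :=
    summable_besselTerm fun n h => hμ (1 - n) (by push_cast; linear_combination h)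
  -- Since `1/Γ(μ+k) = (μ+k)/Γ(μ+k+1)`, the difference carries a factor `k`. It kills the term `k =
  -- 0` and, after an index shift, cancels against the factorial, leaving the series of order `μ +
  -- 1`.
  have key : ∀ k : ℕ, besselTerm (μ - 1) z k - μ * besselTerm μ z k = k * besselTerm μ z k := by
    intro k
    have hk : μ + k ≠ 0 := fun h => hμ (-k) (by push_cast; linear_combination h)
    unfold besselTerm
    rw [show μ - 1 + (k : ℂ) + 1 = μ + k by ring, Complex.Gamma_add_one _ hk]
    have hG : Complex.Gamma (μ + k) ≠ 0 := by
      refine Complex.Gamma_ne_zero fun n hn => hμ (-n - k) ?_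
      push_cast
      linear_combination hn
    have hf : (k.factorial : ℂ) ≠ 0 := by exact_mod_cast k.factorial_ne_zero
    field_simp
    ring
  have hs := (s1.sub (s0.mul_left μ))
  have e := (s1.tsum_sub (s0.mul_left μ))
  rw [tsum_mul_left, hs.tsum_eq_zero_add] at e
  have e2 : ∑' k : ℕ, (besselTerm (μ - 1) z (k + 1) - μ * besselTerm μ z (k + 1)) =
      -(z / 2) ^ 2 * ∑' k, besselTerm (μ + 1) z k := by
    rw [← tsum_mul_left]
    refine tsum_congr fun k => ?_
    rw [key]
    have hf : (k.factorial : ℂ) ≠ 0 := by exact_mod_cast k.factorial_ne_zero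
    have hk' : ((k : ℂ) + 1) ≠ 0 := by exact_mod_cast k.succ_ne_zero
    unfold besselTerm
    rw [Nat.factorial_succ]
    push_cast
    rw [show μ + ((k : ℂ) + 1) + 1 = μ + 1 + k + 1 by ring, mul_div_assoc', mul_assoc ((k : ℂ) + 1),
      mul_div_mul_left _ _ hk', ← mul_div_assoc]
    ring
  rw [e2, key 0] at e
  simp only [Nat.cast_zero, zero_mul] at e
  linear_combination -e

/-- Legendre duplication turns `k! Γ(k+3/2)` into `(2k+1)! √π / 2^(2k+1)`, which gives the sine
series. -/
theorem tsum_besselTerm_half {z : ℂ} (hz : z ≠ 0) :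
    ∑' k, besselTerm (1 / 2) z k = 2 / (Real.sqrt Real.pi : ℂ) * (Complex.sin z / z) := by
  have h := (Complex.hasSum_sin z).mul_left (2 / (Real.sqrt Real.pi : ℂ) / z)
  rw [show 2 / (Real.sqrt Real.pi : ℂ) * (Complex.sin z / z) =
    2 / (Real.sqrt Real.pi : ℂ) / z * Complex.sin z by ring, ← h.tsum_eq]
  refine tsum_congr fun k => ?_
  have hp : (Real.sqrt Real.pi : ℂ) ≠ 0 := by
    exact_mod_cast (Real.sqrt_pos.2 Real.pi_pos).ne'
  have hG := Complex.Gamma_mul_Gamma_add_half (k + 1)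
  rw [Complex.Gamma_nat_eq_factorial, show 2 * ((k : ℂ) + 1) = ((2 * k + 1 : ℕ) : ℂ) + 1 by
    push_cast; ring, Complex.Gamma_nat_eq_factorial] at hG
  rw [show (1 : ℂ) - (((2 * k + 1 : ℕ) : ℂ) + 1) = -((2 * k + 1 : ℕ) : ℂ) by ring,
    Complex.cpow_neg, Complex.cpow_natCast] at hG
  unfold besselTerm
  rw [show (1 / 2 : ℂ) + k + 1 = k + 1 + 1 / 2 by ring, hG, div_pow]
  have hf : ((2 * k + 1).factorial : ℂ) ≠ 0 := by exact_mod_cast Nat.factorial_ne_zero _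
  field_simp
  ring

theorem tsum_besselTerm_neg_half (z : ℂ) :
    ∑' k, besselTerm (-1 / 2) z k = Complex.cos z / (Real.sqrt Real.pi : ℂ) := by
  have h := (Complex.hasSum_cos z).div_const (Real.sqrt Real.pi : ℂ)
  rw [← h.tsum_eq]
  refine tsum_congr fun k => ?_
  have hp : (Real.sqrt Real.pi : ℂ) ≠ 0 := by
    exact_mod_cast (Real.sqrt_pos.2 Real.pi_pos).ne'
  have hG := Complex.Gamma_mul_Gamma_add_half (k + 1 / 2)
  rw [show (k : ℂ) + 1 / 2 + 1 / 2 = k + 1 by ring, Complex.Gamma_nat_eq_factorial,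
    show 2 * ((k : ℂ) + 1 / 2) = ((2 * k : ℕ) : ℂ) + 1 by
    push_cast; ring, Complex.Gamma_nat_eq_factorial] at hG
  rw [show (1 : ℂ) - (((2 * k : ℕ) : ℂ) + 1) = -((2 * k : ℕ) : ℂ) by ring,
    Complex.cpow_neg, Complex.cpow_natCast, mul_comm] at hG
  unfold besselTerm
  rw [show (-1 / 2 : ℂ) + k + 1 = k + 1 / 2 by ring, hG, div_pow]
  have hf : ((2 * k).factorial : ℂ) ≠ 0 := by exact_mod_cast Nat.factorial_ne_zero _
  field_simp

/-- Off the cut the logarithms in the two square roots cancel, leaving the constant `√π/2` and an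
integer power, so no branch enters the recurrence. -/
theorem sphericalBesselJ_eq {z : ℂ} (hz : z ∈ Complex.slitPlane) (m : ℤ) :
    sphericalBesselJ m z =
      (Real.sqrt Real.pi : ℂ) / 2 * (z / 2) ^ m * ∑' k, besselTerm (m + 1 / 2) z k := by
  have hz0 : z ≠ 0 := Complex.slitPlane_ne_zero hz
  have hz2 : z / 2 ≠ 0 := by simpa using hz0
  have h2 : Complex.log (z / 2) = Complex.log z - Real.log 2 := by
    have := Complex.log_ofReal_mul (r := 1 / 2) (by norm_num) hz0
    rw [show ((1 / 2 : ℝ) : ℂ) * z = z / 2 by push_cast; ring] at this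
    rw [this, one_div, Real.log_inv]
    push_cast
    ring
  have h3 : Complex.log (Real.pi / (2 * z)) = Real.log Real.pi - Real.log 2 - Complex.log z := by
    have := Complex.log_ofReal_mul (r := Real.pi / 2) (by positivity) (inv_ne_zero hz0)
    rw [show ((Real.pi / 2 : ℝ) : ℂ) * z⁻¹ = Real.pi / (2 * z) by push_cast; field_simp,
      Complex.log_inv _ (Complex.slitPlane_arg_ne_pi hz),
      Real.log_div Real.pi_ne_zero (by norm_num)] at this
    rw [this]
    push_cast
    ring
  have hK : ((Real.pi : ℂ) / (2 * z)) ^ (1 / 2 : ℂ) * (z / 2) ^ (1 / 2 : ℂ) =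
      (Real.sqrt Real.pi : ℂ) / 2 := by
    rw [Complex.cpow_def_of_ne_zero (div_ne_zero (by exact_mod_cast Real.pi_ne_zero)
      (mul_ne_zero two_ne_zero hz0)), Complex.cpow_def_of_ne_zero hz2, h2, h3, ← Complex.exp_add,
      Real.sqrt_eq_rpow, Real.rpow_def_of_pos Real.pi_pos]
    rw [show (Real.log Real.pi - Real.log 2 - Complex.log z) * (1 / 2) +
      (Complex.log z - Real.log 2) * (1 / 2) =
      ((Real.log Real.pi * (1 / 2) - Real.log 2 : ℝ) : ℂ) by push_cast; ring, ← Complex.ofReal_exp,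
      Real.exp_sub, Real.exp_log two_pos]
    push_cast
    rfl
  unfold sphericalBesselJ besselJ
  rw [add_comm (m : ℂ), Complex.cpow_add _ _ hz2, Complex.cpow_intCast, ← hK]
  simp only [besselTerm]
  ring

theorem intCast_add_half_ne (m n : ℤ) : (m : ℂ) + 1 / 2 ≠ n := by
  intro h
  have h2 : (2 * m + 1 : ℂ) = 2 * n := by linear_combination 2 * h
  norm_cast at h2
  omega

/-- `j_{m+1}(z) + j_{m-1}(z) = (2m+1)/z j_m(z)`. -/
theorem sphericalBesselJ_recurrence {z : ℂ} (hz : z ∈ Complex.slitPlane) (m : ℤ) :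
    sphericalBesselJ (m + 1) z + sphericalBesselJ (m - 1) z =
      (2 * m + 1) / z * sphericalBesselJ m z := by
  have hz0 : z ≠ 0 := Complex.slitPlane_ne_zero hz
  have hz2 : z / 2 ≠ 0 := by simpa using hz0
  have h := tsum_besselTerm_recurrence (z := z) (intCast_add_half_ne m)
  simp only [sphericalBesselJ_eq hz]
  push_cast
  rw [show (m : ℂ) + 1 + 1 / 2 = m + 1 / 2 + 1 by ring,
    show (m : ℂ) - 1 + 1 / 2 = m + 1 / 2 - 1 by ring, zpow_add_one₀ hz2, zpow_sub_one₀ hz2]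
  generalize ∑' k, besselTerm ((m : ℂ) + 1 / 2 - 1) z k = A at *
  generalize ∑' k, besselTerm ((m : ℂ) + 1 / 2 + 1) z k = B at *
  generalize ∑' k, besselTerm ((m : ℂ) + 1 / 2) z k = C at *
  field_simp
  field_simp at h
  linear_combination h

theorem sphericalBesselJ_zero {z : ℂ} (hz : z ∈ Complex.slitPlane) :
    sphericalBesselJ 0 z = Complex.sin z / z := by
  have hp : (Real.sqrt Real.pi : ℂ) ≠ 0 := by
    exact_mod_cast (Real.sqrt_pos.2 Real.pi_pos).ne'
  rw [sphericalBesselJ_eq hz, Int.cast_zero, zero_add,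
    tsum_besselTerm_half (Complex.slitPlane_ne_zero hz)]
  field_simp

theorem sphericalBesselJ_neg_one {z : ℂ} (hz : z ∈ Complex.slitPlane) :
    sphericalBesselJ (-1) z = Complex.cos z / z := by
  have hp : (Real.sqrt Real.pi : ℂ) ≠ 0 := by
    exact_mod_cast (Real.sqrt_pos.2 Real.pi_pos).ne'
  rw [sphericalBesselJ_eq hz, show ((-1 : ℤ) : ℂ) + 1 / 2 = -1 / 2 by push_cast; ring,
    tsum_besselTerm_neg_half, zpow_neg_one]
  field_simp

/-! ### The Gamma sum as a Bessel polynomial -/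

/-- The alternating finite sum in the formula for `j_m`, as a polynomial in `y = (-2iz)⁻¹`. -/
noncomputable def gammaSum (m : ℤ) (y : ℂ) : ℂ :=
  (-1) ^ m * ∑ j ∈ Finset.Icc (1 : ℤ) (-m),
    Complex.Gamma ((j : ℂ) - m - 1) /
      (Complex.Gamma (j : ℂ) * Complex.Gamma (-(j : ℂ) - m + 1)) * y ^ j

/-- The coefficients `(p + i)! / (i! (p - i)!)` of the Bessel polynomials, zero for `i > p`. -/
def besselPolyCoeff (p i : ℕ) : ℕ := (p + i).choose i * p.descFactorial i

theorem besselPolyCoeff_eq_zero {p i : ℕ} (h : p < i) : besselPolyCoeff p i = 0 := by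
  rw [besselPolyCoeff, Nat.descFactorial_of_lt h, mul_zero]

theorem besselPolyCoeff_add (i d : ℕ) :
    (besselPolyCoeff (i + d) i : ℂ) =
      (i + d + i).factorial / (i.factorial * d.factorial) := by
  have h1 := Nat.add_choose_mul_factorial_mul_factorial (i + d) i
  have h2 := Nat.factorial_mul_descFactorial (Nat.le_add_right i d)
  rw [Nat.add_sub_cancel_left] at h2
  have hi : (i.factorial : ℂ) ≠ 0 := by exact_mod_cast Nat.factorial_ne_zero _
  have hd : (d.factorial : ℂ) ≠ 0 := by exact_mod_cast Nat.factorial_ne_zero _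
  rw [eq_div_iff (mul_ne_zero hi hd), ← h1, ← h2, besselPolyCoeff]
  push_cast
  ring

theorem besselPolyCoeff_recurrence (p i : ℕ) :
    (besselPolyCoeff (p + 2) (i + 1) : ℂ) =
      besselPolyCoeff p (i + 1) + 2 * (2 * p + 3) * besselPolyCoeff (p + 1) i := by
  have hi : ((i : ℂ) + 1) ≠ 0 := by exact_mod_cast i.succ_ne_zero
  have hif : (i.factorial : ℂ) ≠ 0 := by exact_mod_cast Nat.factorial_ne_zero _
  rcases lt_or_ge (p + 1) i with h | h
  · simp [besselPolyCoeff_eq_zero h, besselPolyCoeff_eq_zero (show p < i + 1 by omega),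
      besselPolyCoeff_eq_zero (show p + 2 < i + 1 by omega)]
  -- The factorial form needs index at most degree, so the top indices `i = p` and `i = p + 1`,
  -- where the degree `p` coefficient vanishes, are treated apart.
  rcases Nat.lt_or_ge p (i + 1) with h' | h'
  · rw [besselPolyCoeff_eq_zero h']
    obtain rfl | rfl : i = p ∨ i = p + 1 := by omega
    · have a := besselPolyCoeff_add (i + 1) 1
      have b := besselPolyCoeff_add i 1
      rw [show i + 1 + 1 = i + 2 by ring] at a
      rw [a, b, show i + 2 + (i + 1) = i + 1 + i + 1 + 1 by ring, Nat.factorial_succ,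
        Nat.factorial_succ, Nat.factorial_succ]
      push_cast
      field_simp
      ring
    · have a := besselPolyCoeff_add (p + 2) 0
      have b := besselPolyCoeff_add (p + 1) 0
      simp only [add_zero] at a b
      have hp : ((p : ℂ) + 2) ≠ 0 := by exact_mod_cast (p + 1).succ_ne_zero
      rw [show p + 1 + 1 = p + 2 by ring, a, b, show p + 2 + (p + 2) = p + 1 + (p + 1) + 1 + 1 by
        ring, Nat.factorial_succ, Nat.factorial_succ, Nat.factorial_succ (p + 1)]
      push_cast at hi hif ⊢
      field_simp
      ring
  · obtain ⟨d, rfl⟩ := Nat.exists_eq_add_of_le h'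
    have a := besselPolyCoeff_add (i + 1) (d + 2)
    have b := besselPolyCoeff_add i (d + 2)
    have c := besselPolyCoeff_add (i + 1) d
    have hd1 : ((d : ℂ) + 1) ≠ 0 := by exact_mod_cast d.succ_ne_zero
    have hd2 : ((d : ℂ) + 2) ≠ 0 := by exact_mod_cast (d + 1).succ_ne_zero
    have hdf : (d.factorial : ℂ) ≠ 0 := by exact_mod_cast Nat.factorial_ne_zero _
    rw [← add_assoc] at a
    rw [show i + 1 + d + 1 = i + (d + 2) by ring, a, b, c,
      show i + 1 + d + 2 + (i + 1) = i + (d + 2) + i + 1 + 1 by ring,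
      show i + 1 + d + (i + 1) = i + (d + 2) + i by ring, Nat.factorial_succ,
      Nat.factorial_succ, Nat.factorial_succ (d + 1), Nat.factorial_succ d, Nat.factorial_succ i]
    push_cast
    rw [show (d : ℂ) + 1 + 1 = d + 2 by ring]
    field_simp
    ring

theorem gammaSum_of_nonneg {m : ℤ} (hm : 0 ≤ m) (y : ℂ) : gammaSum m y = 0 := by
  rw [gammaSum, Finset.Icc_eq_empty (by omega), Finset.sum_empty, mul_zero]

/-- The sum over `i ≤ p` may be extended, since the coefficients vanish. -/
theorem gammaSum_neg_succ (p : ℕ) {N : ℕ} (hN : p < N) (y : ℂ) :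
    gammaSum (-(p + 1)) y =
      (-1) ^ (p + 1) * (y * ∑ i ∈ Finset.range N, besselPolyCoeff p i * y ^ i) := by
  have e : ∑ i ∈ Finset.range N, (besselPolyCoeff p i : ℂ) * y ^ i =
      ∑ i ∈ Finset.range (p + 1), (besselPolyCoeff p i : ℂ) * y ^ i := by
    symm
    refine Finset.sum_subset (Finset.range_mono hN) fun i _ hi => ?_
    rw [besselPolyCoeff_eq_zero (by simpa using hi), Nat.cast_zero, zero_mul]
  have es : (-1 : ℂ) ^ (-((p : ℤ) + 1)) = (-1) ^ (p + 1) := by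
    rw [zpow_neg, ← Int.natCast_succ, zpow_natCast, ← inv_pow]
    norm_num
  rw [gammaSum, e, es]
  congr 1
  rw [Finset.mul_sum]
  symm
  refine Finset.sum_bij (fun (i : ℕ) _ => (i : ℤ) + 1) (fun i hi => ?_) (fun i _ j _ h => ?_)
    (fun j hj => ?_) (fun i hi => ?_)
  · simp only [Finset.mem_range, Finset.mem_Icc] at hi ⊢
    omega
  · omega
  · simp only [Finset.mem_Icc] at hj
    exact ⟨(j - 1).toNat, by simp only [Finset.mem_range]; omega, by omega⟩
  · obtain ⟨d, rfl⟩ := Nat.exists_eq_add_of_le (Nat.lt_succ_iff.1 (Finset.mem_range.1 hi))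
    rw [besselPolyCoeff_add, ← Int.natCast_succ, zpow_natCast, Nat.succ_eq_add_one]
    push_cast
    rw [show (i : ℂ) + 1 - -(i + d + 1) - 1 = ((i + d + i : ℕ) : ℂ) + 1 by push_cast; ring,
      show -((i : ℂ) + 1) - -(i + d + 1) + 1 = d + 1 by ring, Complex.Gamma_nat_eq_factorial,
      Complex.Gamma_nat_eq_factorial, Complex.Gamma_nat_eq_factorial]
    ring

/-- For `m ≤ -2` this is the Bessel polynomial recurrence; for `m > 0` all sums are empty. The
sources at `0` and `-1` arise where empty and nonempty sums meet. -/
theorem gammaSum_recurrence (m : ℤ) (y : ℂ) :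
    gammaSum (m + 1) y - gammaSum (m - 1) y = -2 * (2 * m + 1) * y * gammaSum m y +
      (if m = 0 then y else if m = -1 then -y else 0) := by
  have g1 : gammaSum (-1) y = -y := by
    have := gammaSum_neg_succ 0 one_pos y
    simpa [besselPolyCoeff] using this
  rcases lt_trichotomy m 0 with hm | rfl | hm
  · obtain ⟨p, rfl⟩ : ∃ p : ℕ, m = -(p + 1) := ⟨(-m - 1).toNat, by omega⟩
    obtain _ | p := p
    · have := gammaSum_neg_succ 1 one_lt_two y
      norm_num [gammaSum_of_nonneg, g1, besselPolyCoeff] at this ⊢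
      rw [this, show Finset.range 2 = Finset.range (1 + 1) from rfl, Finset.sum_range_succ,
        Finset.sum_range_one]
      norm_num
      ring
    -- The ranges are padded with zero coefficients so that, once `i = 0` is split off from `a` and
    -- `c`, all three sums run over `range (p + 2)`.
    · have a := gammaSum_neg_succ p (show p < p + 3 by omega) y
      have b := gammaSum_neg_succ (p + 1) (show p + 1 < p + 2 by omega) y
      have c := gammaSum_neg_succ (p + 2) (show p + 2 < p + 3 by omega) y
      rw [Finset.sum_range_succ'] at a c
      simp only [besselPolyCoeff_recurrence, add_mul, Finset.sum_add_distrib] at c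
      have e : ∑ i ∈ Finset.range (p + 2), 2 * (2 * (p : ℂ) + 3) * besselPolyCoeff (p + 1) i *
          y ^ (i + 1) = 2 * (2 * p + 3) * y *
            ∑ i ∈ Finset.range (p + 2), besselPolyCoeff (p + 1) i * y ^ i := by
        rw [Finset.mul_sum]
        exact Finset.sum_congr rfl fun i _ => by ring
      rw [e] at c
      rw [if_neg (by omega), if_neg (by omega)]
      push_cast at a b c ⊢
      rw [show -((p : ℤ) + 1 + 1) + 1 = -(p + 1) by ring,
        show -((p : ℤ) + 1 + 1) - 1 = -(p + 2 + 1) by ring, a, b, c]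
      simp only [show ∀ q, besselPolyCoeff q 0 = 1 by simp [besselPolyCoeff]]
      push_cast
      ring
  · rw [gammaSum_of_nonneg (by norm_num), gammaSum_of_nonneg le_rfl, zero_sub,
      zero_sub, g1]
    simp
  · rw [gammaSum_of_nonneg (by omega), gammaSum_of_nonneg (by omega), gammaSum_of_nonneg hm.le,
      if_neg (by omega), if_neg (by omega)]
    ring

/-! ### Dawson's integral and the recurrence of its cosine integrals -/

/-- The integral factor of `dawsonF` is a primitive of `exp (w²)`. -/
theorem hasDerivAt_integral_exp_sq (w : ℂ) :
    HasDerivAt (fun w : ℂ => ∫ s in (0 : ℝ)..1, Complex.exp (((s : ℂ) * w) ^ 2) * w)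
      (Complex.exp (w ^ 2)) w := by
  obtain ⟨g, hg⟩ := Differentiable.isExactOn_univ (f := fun w : ℂ => Complex.exp (w ^ 2))
    (by fun_prop)
  have e : (fun w : ℂ => ∫ s in (0 : ℝ)..1, Complex.exp (((s : ℂ) * w) ^ 2) * w) =
      fun w => g w - g 0 := by
    funext w
    have hd : ∀ s ∈ Set.uIcc (0 : ℝ) 1, HasDerivAt (fun s : ℝ => g ((s : ℂ) * w))
        (Complex.exp (((s : ℂ) * w) ^ 2) * w) s := by
      intro s _
      have h1 : HasDerivAt (fun s : ℝ => (s : ℂ) * w) w s := by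
        simpa using (Complex.ofRealCLM.hasDerivAt (x := s)).mul_const w
      exact (hg _ (Set.mem_univ _)).comp s h1
    rw [intervalIntegral.integral_eq_sub_of_hasDerivAt hd
      (Continuous.intervalIntegrable (by fun_prop) _ _)]
    simp
  rw [e]
  exact (hg w (Set.mem_univ _)).sub_const _

/-- Dawson's integral satisfies `F' = 1 - 2wF`. -/
theorem hasDerivAt_dawsonF (w : ℂ) : HasDerivAt dawsonF (1 - 2 * w * dawsonF w) w := by
  have h1 : HasDerivAt (fun w : ℂ => Complex.exp (-w ^ 2)) (Complex.exp (-w ^ 2) * -(2 * w)) w := by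
    simpa using ((hasDerivAt_pow 2 w).neg).cexp
  have h := h1.mul (hasDerivAt_integral_exp_sq w)
  have e : Complex.exp (-w ^ 2) * Complex.exp (w ^ 2) = 1 := by
    rw [← Complex.exp_add, neg_add_cancel, Complex.exp_zero]
  convert! h using 1
  rw [e, dawsonF]
  ring

theorem continuous_dawsonF : Continuous dawsonF :=
  continuous_iff_continuousAt.2 fun w => (hasDerivAt_dawsonF w).continuousAt

/-- The integral `∫_0^π F(-is cos(θ/2)) cos((m+1/2)θ) dθ`. -/
noncomputable def dawsonCosIntegral (m : ℤ) (s : ℂ) : ℂ :=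
  ∫ θ in (0 : ℝ)..Real.pi,
    dawsonF (-Complex.I * s * (Real.cos (θ / 2) : ℂ)) * (Real.cos (((m : ℝ) + 1 / 2) * θ) : ℂ)

theorem dawsonCosIntegral_neg_one (s : ℂ) : dawsonCosIntegral (-1) s = dawsonCosIntegral 0 s := by
  unfold dawsonCosIntegral
  congr 1
  funext θ
  rw [show (((-1 : ℤ) : ℝ) + 1 / 2) * θ = -((((0 : ℤ) : ℝ) + 1 / 2) * θ) by push_cast; ring,
    Real.cos_neg]

theorem integral_cos_int_mul (n : ℤ) :
    ∫ θ in (0 : ℝ)..Real.pi, Real.cos (n * θ) = if n = 0 then Real.pi else 0 := by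
  split_ifs with h
  · simp [h]
  · have hn : (n : ℝ) ≠ 0 := by exact_mod_cast h
    rw [intervalIntegral.integral_comp_mul_left _ hn]
    simp [Real.sin_int_mul_pi]

/-- The product is half the difference of `cos (mθ)` and `cos ((m+1)θ)`, and only a zero frequency
survives integration. This is the source term coming from the `1` in `F' = 1 - 2wF`. -/
theorem integral_sin_half_mul_sin (m : ℤ) :
    ∫ θ in (0 : ℝ)..Real.pi, Real.sin (θ / 2) * Real.sin (((m : ℝ) + 1 / 2) * θ) =
      if m = 0 then Real.pi / 2 else if m = -1 then -(Real.pi / 2) else 0 := by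
  have e : ∀ θ : ℝ, Real.sin (θ / 2) * Real.sin (((m : ℝ) + 1 / 2) * θ) =
      (Real.cos ((m : ℤ) * θ) - Real.cos (((m + 1 : ℤ) : ℝ) * θ)) / 2 := by
    intro θ
    rw [show (m : ℝ) * θ = ((m : ℝ) + 1 / 2) * θ - θ / 2 by ring,
      show ((m + 1 : ℤ) : ℝ) * θ = ((m : ℝ) + 1 / 2) * θ + θ / 2 by push_cast; ring,
      Real.cos_sub, Real.cos_add]
    ring
  simp only [e]
  rw [intervalIntegral.integral_div, intervalIntegral.integral_sub
    (Continuous.intervalIntegrable (by fun_prop) _ _)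
    (Continuous.intervalIntegrable (by fun_prop) _ _), integral_cos_int_mul, integral_cos_int_mul]
  split_ifs <;> first | omega | ring

/-- Integration by parts, using `F' = 1 - 2wF`. -/
theorem dawsonCosIntegral_recurrence (m : ℤ) (s : ℂ) :
    s ^ 2 * (dawsonCosIntegral (m + 1) s - dawsonCosIntegral (m - 1) s) =
      -2 * (2 * m + 1) * dawsonCosIntegral m s - Complex.I * s * Real.pi *
        (if m = 0 then 1 else if m = -1 then -1 else 0) := by
  have hF : Continuous fun θ : ℝ => dawsonF (-Complex.I * s * (Real.cos (θ / 2) : ℂ)) :=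
    continuous_dawsonF.comp (by fun_prop)
  have hd : ∀ θ ∈ Set.uIcc (0 : ℝ) Real.pi, HasDerivAt
      (fun θ : ℝ => dawsonF (-Complex.I * s * (Real.cos (θ / 2) : ℂ)) *
        (Real.sin (((m : ℝ) + 1 / 2) * θ) : ℂ))
      (Complex.I * s / 2 * ((Real.sin (θ / 2) * Real.sin (((m : ℝ) + 1 / 2) * θ) : ℝ) : ℂ) +
        s ^ 2 / 4 * (dawsonF (-Complex.I * s * (Real.cos (θ / 2) : ℂ)) *
            (Real.cos ((((m + 1 : ℤ) : ℝ) + 1 / 2) * θ) : ℂ)) -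
        s ^ 2 / 4 * (dawsonF (-Complex.I * s * (Real.cos (θ / 2) : ℂ)) *
            (Real.cos ((((m - 1 : ℤ) : ℝ) + 1 / 2) * θ) : ℂ)) +
        (m + 1 / 2) * (dawsonF (-Complex.I * s * (Real.cos (θ / 2) : ℂ)) *
            (Real.cos (((m : ℝ) + 1 / 2) * θ) : ℂ))) θ := by
    intro θ _
    have h1 : HasDerivAt (fun θ : ℝ => Real.cos (θ / 2)) (-Real.sin (θ / 2) * (1 / 2)) θ :=
      ((hasDerivAt_id θ).div_const 2).cos
    have h2 : HasDerivAt (fun θ : ℝ => Real.sin (((m : ℝ) + 1 / 2) * θ))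
        (Real.cos (((m : ℝ) + 1 / 2) * θ) * ((m : ℝ) + 1 / 2)) θ := by
      simpa using ((hasDerivAt_id θ).const_mul ((m : ℝ) + 1 / 2)).sin
    have h3 := ((hasDerivAt_dawsonF (-Complex.I * s * (Real.cos (θ / 2) : ℂ))).comp θ
      (h1.ofReal_comp.const_mul (-Complex.I * s))).mul h2.ofReal_comp
    convert! h3 using 1
    -- With `w = -is cos(θ/2)`, the part `-2wF` contributes `-s² sin(θ/2) cos(θ/2) F`; times the
    -- sine this is `s²/4 * F` times the difference of the neighbouring cosines.
    have a1 : Real.cos ((((m + 1 : ℤ) : ℝ) + 1 / 2) * θ) -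
        Real.cos ((((m - 1 : ℤ) : ℝ) + 1 / 2) * θ) =
        -4 * (Real.sin (((m : ℝ) + 1 / 2) * θ) * (Real.sin (θ / 2) * Real.cos (θ / 2))) := by
      rw [show (((m + 1 : ℤ) : ℝ) + 1 / 2) * θ = ((m : ℝ) + 1 / 2) * θ + 2 * (θ / 2) by
          push_cast; ring,
        show (((m - 1 : ℤ) : ℝ) + 1 / 2) * θ = ((m : ℝ) + 1 / 2) * θ - 2 * (θ / 2) by
          push_cast; ring, Real.cos_add, Real.cos_sub, Real.sin_two_mul]
      ring
    have a2 := congrArg (fun r : ℝ => (r : ℂ)) a1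
    simp only [Complex.ofReal_sub, Complex.ofReal_mul] at a2
    simp only [Function.comp_apply]
    push_cast at a2 ⊢
    linear_combination (s ^ 2 / 4 * dawsonF (-Complex.I * s * Complex.cos ((θ : ℂ) / 2))) * a2 -
      s ^ 2 * Complex.sin (((m : ℂ) + 1 / 2) * θ) * Complex.sin (θ / 2) * Complex.cos (θ / 2) *
        dawsonF (-Complex.I * s * Complex.cos ((θ : ℂ) / 2)) * Complex.I_sq
  have hi : ∀ n : ℤ, IntervalIntegrable (fun θ : ℝ =>
      dawsonF (-Complex.I * s * (Real.cos (θ / 2) : ℂ)) *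
        (Real.cos (((n : ℝ) + 1 / 2) * θ) : ℂ)) MeasureTheory.volume 0 Real.pi :=
    fun n => Continuous.intervalIntegrable (hF.mul (by fun_prop)) _ _
  have hi0 : IntervalIntegrable (fun θ : ℝ =>
      Complex.I * s / 2 * ((Real.sin (θ / 2) * Real.sin (((m : ℝ) + 1 / 2) * θ) : ℝ) : ℂ))
      MeasureTheory.volume 0 Real.pi := Continuous.intervalIntegrable (by fun_prop) _ _
  have h := intervalIntegral.integral_eq_sub_of_hasDerivAt hd
    (((hi0.add ((hi (m + 1)).const_mul _)).sub ((hi (m - 1)).const_mul _)).add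
      ((hi m).const_mul _))
  rw [intervalIntegral.integral_add
      ((hi0.add ((hi (m + 1)).const_mul _)).sub ((hi (m - 1)).const_mul _)) ((hi m).const_mul _),
    intervalIntegral.integral_sub (hi0.add ((hi (m + 1)).const_mul _)) ((hi (m - 1)).const_mul _),
    intervalIntegral.integral_add hi0 ((hi (m + 1)).const_mul _)] at h
  simp only [intervalIntegral.integral_const_mul, intervalIntegral.integral_ofReal,
    integral_sin_half_mul_sin] at h
  -- Both boundary terms vanish: the argument of `F` is `0` at `θ = π`, and the sine is `0` at `θ =
  -- 0`.
  have hF0 : dawsonF 0 = 0 := by simp [dawsonF]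
  simp only [Real.cos_pi_div_two, Complex.ofReal_zero, mul_zero, hF0, zero_mul, Real.sin_zero,
    sub_zero] at h
  have hD : ∀ n : ℤ, ∫ θ in (0 : ℝ)..Real.pi,
      dawsonF (-Complex.I * s * (Real.cos (θ / 2) : ℂ)) *
        (Real.cos (((n : ℝ) + 1 / 2) * θ) : ℂ) = dawsonCosIntegral n s := fun _ => rfl
  simp only [hD] at h
  have e : ((if m = 0 then Real.pi / 2 else if m = -1 then -(Real.pi / 2) else 0 : ℝ) : ℂ) =
      Real.pi / 2 * (if m = 0 then 1 else if m = -1 then -1 else 0) := by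
    split_ifs <;> push_cast <;> ring
  rw [e] at h
  linear_combination 4 * h

/-! ### Wallis integrals and the initial value of the cosine integral -/

/-- The Wallis integrals over `[0, 1]`. -/
noncomputable def wallis (k : ℕ) : ℝ := ∫ t in (0 : ℝ)..1, (1 - t ^ 2) ^ k

theorem wallis_succ (k : ℕ) : (2 * k + 3) * wallis (k + 1) = (2 * k + 2) * wallis k := by
  have hd : ∀ t ∈ Set.uIcc (0 : ℝ) 1, HasDerivAt (fun t : ℝ => t * (1 - t ^ 2) ^ (k + 1))
      ((2 * k + 3) * (1 - t ^ 2) ^ (k + 1) - (2 * k + 2) * (1 - t ^ 2) ^ k) t := by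
    intro t _
    have := (hasDerivAt_id t).mul (((hasDerivAt_pow 2 t).const_sub 1).pow (k + 1))
    convert! this using 1
    simp
    ring
  have h := intervalIntegral.integral_eq_sub_of_hasDerivAt hd
    (Continuous.intervalIntegrable (by fun_prop) _ _)
  rw [intervalIntegral.integral_sub (Continuous.intervalIntegrable (by fun_prop) _ _)
    (Continuous.intervalIntegrable (by fun_prop) _ _), intervalIntegral.integral_const_mul,
    intervalIntegral.integral_const_mul] at h
  simp at h
  simp only [wallis]
  linear_combination h

theorem wallis_nonneg (k : ℕ) : 0 ≤ wallis k :=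
  intervalIntegral.integral_nonneg zero_le_one fun t ht =>
    pow_nonneg (by nlinarith [ht.1, ht.2]) _

theorem wallis_le_one (k : ℕ) : wallis k ≤ 1 := by
  induction k with
  | zero => simp [wallis]
  | succ k ih =>
    have := wallis_succ k
    have hk : (0 : ℝ) ≤ k := k.cast_nonneg
    nlinarith [wallis_nonneg (k + 1), wallis_nonneg k]

/-- From `k` to `k+1` the factors change by `(2k+2)/(2k+3)` and `(2k+3)/(2k+4)`, so the product
telescopes. -/
theorem wallis_mul_integral_cos_pow (k : ℕ) :
    wallis k * ∫ θ in (0 : ℝ)..Real.pi, Real.cos (θ / 2) ^ (2 * k + 2) =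
      Real.pi / (2 * (k + 1)) := by
  have e : ∀ n : ℕ, ∫ θ in (0 : ℝ)..Real.pi, Real.cos (θ / 2) ^ n =
      2 * ∫ θ in (0 : ℝ)..(Real.pi / 2), Real.cos θ ^ n := by
    intro n
    have := intervalIntegral.integral_comp_div (a := 0) (b := Real.pi)
      (fun θ => Real.cos θ ^ n) (two_ne_zero (α := ℝ))
    simpa using this
  simp only [e]
  induction k with
  | zero =>
    simp [wallis, integral_cos_sq]
    ring
  | succ k ih =>
    have h := wallis_succ k
    have hc := integral_cos_pow (a := 0) (b := Real.pi / 2) (2 * k + 2)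
    rw [Real.cos_pi_div_two, Real.sin_zero, zero_pow (by omega), zero_mul, mul_zero, sub_zero,
      zero_div, zero_add] at hc
    rw [show 2 * (k + 1) + 2 = 2 * k + 2 + 2 by ring, hc]
    push_cast
    generalize (∫ θ in (0 : ℝ)..(Real.pi / 2), Real.cos θ ^ (2 * k + 2)) = C at *
    have hw : wallis (k + 1) = (2 * k + 2) / (2 * k + 3) * wallis k := by
      field_simp
      linear_combination h
    field_simp at ih
    rw [hw]
    field_simp
    linear_combination (2 * k + 3) * ih

/-- The power series of Dawson's integral. -/
theorem hasSum_dawsonF (w : ℂ) :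
    HasSum (fun k : ℕ => w * ((-w ^ 2) ^ k / k.factorial * (wallis k : ℂ))) (dawsonF w) := by
  -- Merging the exponentials gives an integrand in powers of `1 - t²`, whose integrals are `wallis
  -- k`.
  have e : dawsonF w = w * ∫ t in (0 : ℝ)..1, Complex.exp (-w ^ 2 * ((1 - t ^ 2 : ℝ) : ℂ)) := by
    rw [dawsonF, ← intervalIntegral.integral_const_mul, ← intervalIntegral.integral_const_mul]
    congr 1
    funext t
    rw [← mul_assoc, ← Complex.exp_add, mul_comm]
    congr 2
    push_cast
    ring
  rw [e]
  refine HasSum.mul_left _ ?_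
  have key := intervalIntegral.hasSum_integral_of_dominated_convergence
    (μ := MeasureTheory.volume) (a := 0) (b := 1)
    (F := fun (k : ℕ) (t : ℝ) => (-w ^ 2) ^ k / k.factorial * (((1 - t ^ 2) ^ k : ℝ) : ℂ))
    (f := fun t : ℝ => Complex.exp (-w ^ 2 * ((1 - t ^ 2 : ℝ) : ℂ)))
    (fun k _ => ‖w ^ 2‖ ^ k / k.factorial)
    (fun k => Continuous.aestronglyMeasurable (by fun_prop))
    (fun k => Filter.Eventually.of_forall fun t ht => ?_)
    (Filter.Eventually.of_forall fun t _ => Real.summable_pow_div_factorial _)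
    intervalIntegrable_const
    (Filter.Eventually.of_forall fun t _ => ?_)
  · simpa only [intervalIntegral.integral_const_mul, intervalIntegral.integral_ofReal, wallis]
      using key
  · rw [Set.uIoc_of_le zero_le_one] at ht
    have h0 : 0 ≤ 1 - t ^ 2 := by nlinarith [ht.1, ht.2]
    have h1 : 1 - t ^ 2 ≤ 1 := by nlinarith
    rw [norm_mul, norm_div, norm_pow, norm_neg, Complex.norm_natCast, Complex.norm_real,
      Real.norm_of_nonneg (pow_nonneg h0 _)]
    exact mul_le_of_le_one_right (by positivity) (pow_le_one₀ h0 h1)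
  · have := NormedSpace.expSeries_div_hasSum_exp (-w ^ 2 * ((1 - t ^ 2 : ℝ) : ℂ))
    rw [← Complex.exp_eq_exp_ℂ] at this
    convert! this using 2 with k
    push_cast
    rw [mul_pow]
    ring

/-- The weight `cos(θ/2)` and the outer factor `w` raise the cosine power to `2k+2`; the Wallis
product then turns `1/k!` into `1/(k+1)!`, up to the constant `π/2`. -/
theorem dawsonCosIntegral_zero (s : ℂ) :
    s ^ 2 * dawsonCosIntegral 0 s =
      -Complex.I * s * (Real.pi / 2) * (Complex.exp (s ^ 2) - 1) := by
  have key := intervalIntegral.hasSum_integral_of_dominated_convergence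
    (μ := MeasureTheory.volume) (a := 0) (b := Real.pi)
    (F := fun (k : ℕ) (θ : ℝ) => -Complex.I * s * ((s ^ 2) ^ k / k.factorial * (wallis k : ℂ)) *
      ((Real.cos (θ / 2) ^ (2 * k + 2) : ℝ) : ℂ))
    (f := fun θ : ℝ => dawsonF (-Complex.I * s * (Real.cos (θ / 2) : ℂ)) *
      (Real.cos ((((0 : ℤ) : ℝ) + 1 / 2) * θ) : ℂ))
    (fun k _ => ‖s‖ * (‖s ^ 2‖ ^ k / k.factorial))
    (fun k => Continuous.aestronglyMeasurable (by fun_prop))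
    (fun k => Filter.Eventually.of_forall fun t ht => ?_)
    (Filter.Eventually.of_forall fun t _ => (Real.summable_pow_div_factorial _).mul_left _)
    intervalIntegrable_const
    (Filter.Eventually.of_forall fun t _ => ?_)
  · simp only [intervalIntegral.integral_const_mul, intervalIntegral.integral_ofReal] at key
    have h1 := key.mul_left (s ^ 2)
    have h2 := NormedSpace.expSeries_div_hasSum_exp (s ^ 2)
    rw [← Complex.exp_eq_exp_ℂ, ← hasSum_nat_add_iff' 1] at h2
    simp only [Finset.sum_range_one, pow_zero, Nat.factorial_zero, Nat.cast_one, div_one] at h2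
    have h3 := h2.mul_left (-Complex.I * s * (Real.pi / 2))
    refine h1.unique ?_
    convert! h3 using 2 with k
    have hw := congrArg (fun r : ℝ => (r : ℂ)) (wallis_mul_integral_cos_pow k)
    simp only [Complex.ofReal_mul, Complex.ofReal_div] at hw
    have hk : ((k : ℂ) + 1) ≠ 0 := by exact_mod_cast k.succ_ne_zero
    have hf : (k.factorial : ℂ) ≠ 0 := by exact_mod_cast k.factorial_ne_zero
    rw [show ∀ a b c d e : ℂ, a * (b * (c * d) * e) = a * (b * (c * (d * e))) by intros; ring, hw,
      Nat.factorial_succ]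
    push_cast
    field_simp
    ring
  · rw [norm_mul, norm_mul, norm_mul, norm_mul, norm_neg, Complex.norm_I, one_mul, norm_div,
      norm_pow, Complex.norm_natCast, Complex.norm_real, Complex.norm_real,
      Real.norm_of_nonneg (wallis_nonneg k), Real.norm_eq_abs, abs_pow]
    have hc := pow_le_one₀ (n := 2 * k + 2) (abs_nonneg _) (Real.abs_cos_le_one (t / 2))
    have h4 : ‖s‖ * (‖s ^ 2‖ ^ k / k.factorial * wallis k) ≤
        ‖s‖ * (‖s ^ 2‖ ^ k / k.factorial) :=
      mul_le_mul_of_nonneg_left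
        (mul_le_of_le_one_right (by positivity) (wallis_le_one k)) (norm_nonneg _)
    refine (mul_le_of_le_one_right ?_ hc).trans h4
    have := wallis_nonneg k
    positivity
  · have := (hasSum_dawsonF (-Complex.I * s * (Real.cos (t / 2) : ℂ))).mul_right
      (Real.cos ((((0 : ℤ) : ℝ) + 1 / 2) * t) : ℂ)
    convert! this using 2 with k
    rw [show (((0 : ℤ) : ℝ) + 1 / 2) * t = t / 2 by push_cast; ring]
    have hI : -(-Complex.I * s * (Real.cos (t / 2) : ℂ)) ^ 2 =
        s ^ 2 * (Real.cos (t / 2) : ℂ) ^ 2 := by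
      linear_combination (-s ^ 2 * (Real.cos (t / 2) : ℂ) ^ 2) * Complex.I_sq
    rw [hI, mul_pow, ← pow_mul, ← pow_mul, Complex.ofReal_pow, pow_add]
    ring

/-! ### The branch of the powers of `-2iz` -/

theorem powNegTwoIMul_half_sq (z : ℂ) :
    powNegTwoIMul z (1 / 2) ^ 2 = -2 * Complex.I * z := by
  rw [powNegTwoIMul, mul_pow, ← Complex.exp_nat_mul, ← Complex.cpow_nat_mul]
  rw [show ((2 : ℕ) : ℂ) * -(Complex.I * Real.pi * (1 / 2) / 2) = -(Real.pi / 2 * Complex.I) by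
    push_cast; ring, Complex.exp_neg, Complex.exp_mul_I, Complex.cos_pi_div_two,
    Complex.sin_pi_div_two]
  norm_num
  ring

theorem powNegTwoIMul_half_ne_zero {z : ℂ} (hz : z ≠ 0) : powNegTwoIMul z (1 / 2) ≠ 0 := by
  intro h
  refine mul_ne_zero (show -2 * Complex.I ≠ 0 by simp) hz ?_
  rw [← powNegTwoIMul_half_sq, h, zero_pow two_ne_zero]

theorem powNegTwoIMul_half_sub_int {z : ℂ} (hz : z ≠ 0) (j : ℤ) :
    powNegTwoIMul z (1 / 2 - j) = powNegTwoIMul z (1 / 2) * ((-2 * Complex.I * z)⁻¹) ^ j := by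
  have e : Complex.exp (Real.pi / 2 * Complex.I * j) = Complex.I ^ j := by
    rw [mul_comm, Complex.exp_int_mul, Complex.exp_pi_div_two_mul_I]
  rw [powNegTwoIMul, powNegTwoIMul, Complex.cpow_sub _ _ (mul_ne_zero two_ne_zero hz),
    Complex.cpow_intCast,
    show -(Complex.I * Real.pi * (1 / 2 - j) / 2) =
      -(Complex.I * Real.pi * (1 / 2) / 2) + Real.pi / 2 * Complex.I * j by ring,
    Complex.exp_add, e, show (-2 * Complex.I * z)⁻¹ = Complex.I * (2 * z)⁻¹ by
      rw [show -2 * Complex.I * z = -Complex.I * (2 * z) by ring, mul_inv, inv_neg,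
        Complex.inv_I, neg_neg], mul_zpow Complex.I (2 * z)⁻¹, inv_zpow]
  ring

/-- In the sector `-π/2 < arg z`, the branch is the principal one. -/
theorem powNegTwoIMul_eq_cpow {z : ℂ} (hz : z ≠ 0) (h : -(Real.pi / 2) < z.arg) (a : ℂ) :
    powNegTwoIMul z a = (-2 * Complex.I * z) ^ a := by
  have hx : -2 * Complex.I * z ≠ 0 := by simp [hz]
  have hl : Complex.log (-2 * Complex.I * z) = Complex.log (2 * z) - Real.pi / 2 * Complex.I := by
    have e : -2 * Complex.I * z = Complex.exp (Complex.log (2 * z) - Real.pi / 2 * Complex.I) := by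
      rw [Complex.exp_sub, Complex.exp_log (mul_ne_zero two_ne_zero hz),
        Complex.exp_pi_div_two_mul_I, div_eq_mul_inv, Complex.inv_I]
      ring
    have harg : (2 * z).arg = z.arg := by
      have := Complex.arg_real_mul z two_pos
      simpa using this
    have him : (Complex.log (2 * z) - Real.pi / 2 * Complex.I).im = z.arg - Real.pi / 2 := by
      rw [Complex.sub_im, Complex.log_im, harg]
      norm_num
    -- The bound on `arg z` is what keeps `arg z - π/2` above `-π`.
    rw [e, Complex.log_exp] <;> rw [him]
    · linarith
    · linarith [Complex.arg_le_pi z, Real.pi_pos]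
  rw [powNegTwoIMul, Complex.cpow_def_of_ne_zero (mul_ne_zero two_ne_zero hz),
    Complex.cpow_def_of_ne_zero hx, hl, ← Complex.exp_add]
  congr 1
  ring

/-- The phase `e^(-iπ/4)` of the branch cancels the half power of `i`, and `√(2z) = √2 √z` cancels
`√z`. -/
theorem dawson_prefactor {z : ℂ} (hz : z ≠ 0) (m : ℤ) :
    (Real.sqrt 2 : ℂ) * Complex.I ^ ((m : ℂ) + 3 / 2) *
        (Complex.exp (Complex.I * z) / z ^ (1 / 2 : ℂ)) * powNegTwoIMul z (1 / 2) =
      2 * Complex.I ^ (m + 1) * Complex.exp (Complex.I * z) := by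
  have hz2 : z ^ (1 / 2 : ℂ) ≠ 0 := by simp [Complex.cpow_eq_zero_iff, hz]
  have h2 : (2 * z) ^ (1 / 2 : ℂ) = (Real.sqrt 2 : ℂ) * z ^ (1 / 2 : ℂ) := by
    have := Complex.log_ofReal_mul two_pos hz
    rw [Complex.ofReal_ofNat] at this
    rw [Complex.cpow_def_of_ne_zero (mul_ne_zero two_ne_zero hz), this, add_mul, Complex.exp_add,
      ← Complex.cpow_def_of_ne_zero hz, Real.sqrt_eq_rpow, Real.rpow_def_of_pos two_pos]
    push_cast
    rfl
  have hs : (Real.sqrt 2 : ℂ) * Real.sqrt 2 = 2 := by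
    exact_mod_cast Real.mul_self_sqrt zero_le_two
  have hI : Complex.I ^ ((m : ℂ) + 3 / 2) =
      Complex.I ^ (m + 1) * Complex.exp (Complex.I * Real.pi * (1 / 2) / 2) := by
    rw [show (m : ℂ) + 3 / 2 = ((m + 1 : ℤ) : ℂ) + 1 / 2 by push_cast; ring,
      Complex.cpow_add _ _ Complex.I_ne_zero, Complex.cpow_intCast,
      Complex.cpow_def_of_ne_zero Complex.I_ne_zero, Complex.log_I]
    congr 2
    ring
  rw [powNegTwoIMul, Complex.exp_neg, h2, hI]
  have he := Complex.exp_ne_zero (Complex.I * Real.pi * (1 / 2) / 2)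
  field_simp
  linear_combination hs

/-! ### Recurrence and initial values of the right-hand side; conclusion -/

/-- The right-hand side of the formula for `j_m`, after the prefactors are collected. -/
noncomputable def dawsonRepr (z : ℂ) (m : ℤ) : ℂ :=
  2 * Complex.I ^ (m + 1) * Complex.exp (Complex.I * z) *
    (dawsonCosIntegral m (powNegTwoIMul z (1 / 2)) / (Real.pi * powNegTwoIMul z (1 / 2)) +
      Complex.I * gammaSum m (-2 * Complex.I * z)⁻¹)

theorem dawsonRepr_recurrence {z : ℂ} (hz : z ≠ 0) (m : ℤ) :
    dawsonRepr z (m + 1) + dawsonRepr z (m - 1) = (2 * m + 1) / z * dawsonRepr z m := by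
  have hs := powNegTwoIMul_half_ne_zero hz
  have hx := powNegTwoIMul_half_sq z
  have hp : (Real.pi : ℂ) ≠ 0 := by exact_mod_cast Real.pi_ne_zero
  have h1 := dawsonCosIntegral_recurrence m (powNegTwoIMul z (1 / 2))
  have h2 := gammaSum_recurrence m (-2 * Complex.I * z)⁻¹
  have hc : (if m = 0 then (-2 * Complex.I * z)⁻¹ else
      if m = -1 then -(-2 * Complex.I * z)⁻¹ else 0) =
      (-2 * Complex.I * z)⁻¹ * (if m = 0 then 1 else if m = -1 then -1 else 0) := by
    split_ifs <;> ring
  rw [hc] at h2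
  have hz' : (2 * m + 1) / z = (2 * m + 1) * (-2 * Complex.I * (-2 * Complex.I * z)⁻¹) := by
    have := Complex.I_ne_zero
    field_simp
  rw [← hx] at h2 hz'
  unfold dawsonRepr
  rw [hz', ← hx, show m - 1 + 1 = m + 1 - 1 by ring, zpow_add_one₀ Complex.I_ne_zero (m + 1),
    zpow_sub_one₀ Complex.I_ne_zero (m + 1), Complex.inv_I]
  generalize powNegTwoIMul z (1 / 2) = s at *
  generalize (if m = 0 then (1 : ℂ) else if m = -1 then -1 else 0) = d at *
  have h3 : dawsonCosIntegral (m + 1) s / (Real.pi * s) - dawsonCosIntegral (m - 1) s /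
      (Real.pi * s) = -2 * (2 * m + 1) * (s ^ 2)⁻¹ * (dawsonCosIntegral m s / (Real.pi * s)) -
        Complex.I * (s ^ 2)⁻¹ * d := by
    field_simp
    linear_combination h1
  linear_combination 2 * Complex.I ^ (m + 1) * Complex.exp (Complex.I * z) * Complex.I *
    (h3 + Complex.I * h2)

theorem dawsonRepr_zero {z : ℂ} (hz : z ≠ 0) : dawsonRepr z 0 = Complex.sin z / z := by
  have hs := powNegTwoIMul_half_ne_zero hz
  have hx := powNegTwoIMul_half_sq z
  have hp : (Real.pi : ℂ) ≠ 0 := by exact_mod_cast Real.pi_ne_zero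
  have h1 := dawsonCosIntegral_zero (powNegTwoIMul z (1 / 2))
  have h3 : dawsonCosIntegral 0 (powNegTwoIMul z (1 / 2)) /
      (Real.pi * powNegTwoIMul z (1 / 2)) = (Complex.exp (-2 * Complex.I * z) - 1) / (4 * z) := by
    rw [← hx]
    rw [div_eq_div_iff (mul_ne_zero hp hs) (by simp [hz])]
    rw [hx] at h1 ⊢
    linear_combination 2 * Complex.I * h1 + (4 * z * dawsonCosIntegral 0 (powNegTwoIMul z (1 / 2)) -
      Real.pi * powNegTwoIMul z (1 / 2) * (Complex.exp (-2 * Complex.I * z) - 1)) * Complex.I_sq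
  have e1 : Complex.exp (Complex.I * z) * Complex.exp (-2 * Complex.I * z) =
      Complex.exp (-z * Complex.I) := by
    rw [← Complex.exp_add]
    congr 1
    ring
  rw [dawsonRepr, h3, gammaSum_of_nonneg le_rfl, Complex.sin, mul_comm z Complex.I, ← e1,
    zero_add, zpow_one]
  field_simp
  ring

/-- The integral is the one for `m = 0`; the single Gamma term adds `e^(iz)/z`, and `e^(iz) - i sin
z = cos z`. -/
theorem dawsonRepr_neg_one {z : ℂ} (hz : z ≠ 0) : dawsonRepr z (-1) = Complex.cos z / z := by
  have h0 := dawsonRepr_zero hz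
  have g1 : ∀ y, gammaSum (-1) y = -y := by
    intro y
    have := gammaSum_neg_succ 0 one_pos y
    simpa [besselPolyCoeff] using this
  rw [dawsonRepr, gammaSum_of_nonneg le_rfl] at h0
  rw [dawsonRepr, dawsonCosIntegral_neg_one, g1]
  have hI := Complex.I_ne_zero
  have e := Complex.exp_mul_I z
  rw [mul_comm z Complex.I] at e
  rw [zero_add, zpow_one, mul_zero, add_zero] at h0
  generalize dawsonCosIntegral 0 (powNegTwoIMul z (1 / 2)) /
    (Real.pi * powNegTwoIMul z (1 / 2)) = D at *
  rw [neg_add_cancel, zpow_zero]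
  field_simp at h0 ⊢
  have e2 : Complex.cos z = Complex.exp (Complex.I * z) - Complex.sin z * Complex.I := by rw [e]; ring
  rw [e2, ← h0]
  linear_combination 2 * z * Complex.exp (Complex.I * z) * D * Complex.I_sq

theorem sphericalBesselJ_eq_dawsonRepr {z : ℂ} (hz : z ∈ Complex.slitPlane) (m : ℤ) :
    sphericalBesselJ m z = dawsonRepr z m := by
  have hz0 := Complex.slitPlane_ne_zero hz
  refine eq_of_three_term_recurrence (f := fun m => sphericalBesselJ m z)
    (c := fun m => (2 * m + 1) / z) (sphericalBesselJ_recurrence hz) (dawsonRepr_recurrence hz0)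
    ?_ ?_ m
  · rw [sphericalBesselJ_zero hz, dawsonRepr_zero hz0]
  · rw [sphericalBesselJ_neg_one hz, dawsonRepr_neg_one hz0]

theorem mainTheorem6 (m : ℤ) (z : ℂ) (hz : z ∈ Complex.slitPlane) :
    (sphericalBesselJ m z =
      (Real.sqrt 2 : ℂ) * Complex.I ^ ((m : ℂ) + 3 / 2) *
          (Complex.exp (Complex.I * z) / z ^ (1 / 2 : ℂ)) *
        ((1 / (Real.pi : ℂ)) *
            (∫ θ in (0 : ℝ)..Real.pi,
              dawsonF (-Complex.I * powNegTwoIMul z (1 / 2) * (Real.cos (θ / 2) : ℂ)) *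
                (Real.cos (((m : ℝ) + 1 / 2) * θ) : ℂ)) +
          Complex.I * (-1 : ℂ) ^ m *
            ∑ j ∈ Finset.Icc (1 : ℤ) (-m),
              Complex.Gamma ((j : ℂ) - m - 1) /
                  (Complex.Gamma (j : ℂ) * Complex.Gamma (-(j : ℂ) - m + 1)) *
                powNegTwoIMul z (1 / 2 - (j : ℂ)))) ∧
    (-(Real.pi / 2) < Complex.arg z →
      sphericalBesselJ m z =
        (Real.sqrt 2 : ℂ) * Complex.I ^ ((m : ℂ) + 3 / 2) *
            (Complex.exp (Complex.I * z) / z ^ (1 / 2 : ℂ)) *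
          ((1 / (Real.pi : ℂ)) *
              (∫ θ in (0 : ℝ)..Real.pi,
                dawsonF (-Complex.I * (-2 * Complex.I * z) ^ (1 / 2 : ℂ) *
                    (Real.cos (θ / 2) : ℂ)) *
                  (Real.cos (((m : ℝ) + 1 / 2) * θ) : ℂ)) +
            Complex.I * (-1 : ℂ) ^ m *
              ∑ j ∈ Finset.Icc (1 : ℤ) (-m),
                Complex.Gamma ((j : ℂ) - m - 1) /
                    (Complex.Gamma (j : ℂ) * Complex.Gamma (-(j : ℂ) - m + 1)) *
                  (-2 * Complex.I * z) ^ (1 / 2 - (j : ℂ)))) := by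
  have hz0 := Complex.slitPlane_ne_zero hz
  have hs := powNegTwoIMul_half_ne_zero hz0
  have hp : (Real.pi : ℂ) ≠ 0 := by exact_mod_cast Real.pi_ne_zero
  have key : ∀ {A B : Prop}, A → (A → B) → A ∧ B := fun a f => ⟨a, f a⟩
  refine key ?_ fun h harg => ?_
  rotate_left
  · simpa only [powNegTwoIMul_eq_cpow hz0 harg] using h
  · rw [sphericalBesselJ_eq_dawsonRepr hz, dawsonRepr, ← dawson_prefactor hz0, gammaSum,
      ← dawsonCosIntegral]
    simp only [powNegTwoIMul_half_sub_int hz0]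
    rw [show ∀ f : ℤ → ℂ, ∀ g : ℤ → ℂ, ∑ j ∈ Finset.Icc (1 : ℤ) (-m),
        f j * (powNegTwoIMul z (1 / 2) * g j) = powNegTwoIMul z (1 / 2) *
          ∑ j ∈ Finset.Icc (1 : ℤ) (-m), f j * g j from fun f g => by
        rw [Finset.mul_sum]
        exact Finset.sum_congr rfl fun j _ => by ring]
    field_simp
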